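/- Let $(\Omega,\mathcal A,\mu)$ be a complete $\sigma$-finite measure space with $\mu(\Omega)>0$, and let $M\colon\Omega\rightrightarrows\mathbb R^n$ be a set-valued mapping such that every $M(\omega)$ is a closed cone (nonempty, closed under multiplication by positive scalars, not necessarily convex) and $M$ is measurable, i.e. $\{\omega\in\Omega : M(\omega)\cap U\neq\emptyset\}\in\mathcal A$ for every open $U\subset\mathbb R^n$. Let $$M_\cap:=\{x\in\mathbb R^n : x\in M(\omega)\text{ for $\mu$-almost all }\omega\in\Omega\}$$ be the essential intersection of $M$. For $\Theta\subset\mathbb R^n$ and $\bar x\in\Theta$, let $$\widehat N(\bar x;\Theta):=\Big\{x^*\in\mathbb R^n : \limsup_{x\to\bar x,\ x\in\Theta\setminus\{\bar x\}}\frac{\langle x^*,x-\bar x\rangle}{\|x-\bar x\|}\le 0\Big\}$$ be the regular (Fréchet) normal cone, the upper limit being $-\infty$ if $\bar x$ is isolated in $\Theta$, and let the limiting (Mordukhovich) normal cone $N(\bar x;\Theta)$ be the set of all limits of sequences $x_k^*\in\widehat N(x_k;\Theta)$ with $x_k\in\Theta$, $x_k\to\bar x$; for $\bar x\notin\Theta$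 both cones are empty. Finally, for $F\colon\Omega\rightrightarrows\mathbb R^n$ let $$\int_\Omega F(\omega)\,d\mu(\omega):=\Big\{\int_\Omega x^*(\omega)\,d\mu(\omega) : x^*\in L^1(\Omega,\mathbb R^n),\ x^*(\omega)\in F(\omega)\text{ a.e.}\Big\}$$ be the Aumann integral. Then $$N(x;M_\cap)\subset\operatorname{cl}\Big(\int_\Omega N\big(0;M(\omega)\big)\,d\mu(\omega)\Big)\quad\text{for all }x\in\mathbb R^n.$$ -/

import Mathlib

open MeasureTheory Filter Topology

noncomputable section

namespace EssInter

variable {E : Type*} [NormedAddCommGroup E] [InnerProductSpace ℝ E]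

/-- The Fréchet regular normal cone `N̂(x; Θ)` of a set `Θ` at `x ∈ Θ` (empty if `x ∉ Θ`).
The upper limit is over `y → x` with `y ∈ Θ`, `y ≠ x`; it is taken in the extended reals, so it
is `-∞` when `x` is an isolated point of `Θ`. -/
def regularNormalCone (x : E) (Θ : Set E) : Set E :=
  {v | x ∈ Θ ∧
    limsup (fun y : E => ((inner ℝ v (y - x) / ‖y - x‖ : ℝ) : EReal)) (𝓝[Θ \ {x}] x) ≤ 0}

/-- The Mordukhovich basic/limiting normal cone `N(x; Θ)` of a set `Θ` at `x ∈ Θ`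
(empty if `x ∉ Θ`): the sequential outer limit of `N̂(y; Θ)` as `y → x` with `y ∈ Θ`. -/
def limitingNormalCone (x : E) (Θ : Set E) : Set E :=
  {v | x ∈ Θ ∧ ∃ (y : ℕ → E) (w : ℕ → E),
    (∀ k, y k ∈ Θ) ∧ Tendsto y atTop (𝓝 x) ∧ Tendsto w atTop (𝓝 v) ∧
      ∀ k, w k ∈ regularNormalCone (y k) Θ}

/-- Closed (nonempty, not necessarily convex) cones. -/
structure IsClosedCone (K : Set E) : Prop where
  isClosed : IsClosed K
  nonempty : K.Nonempty
  smul_mem : ∀ c : ℝ, 0 < c → ∀ x ∈ K, c • x ∈ K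

variable {Ω : Type*} [MeasurableSpace Ω]

/-- Measurability of a set-valued mapping: the inverse image
`M⁻¹(U) = {ω | M(ω) ∩ U ≠ ∅}` of every open set `U` is measurable. -/
def MeasurableMultifunction (M : Ω → Set E) : Prop :=
  ∀ U : Set E, IsOpen U → MeasurableSet {ω | (M ω ∩ U).Nonempty}

/-- The essential intersection of a set-valued mapping. -/
def essIntersection (μ : Measure Ω) (M : Ω → Set E) : Set E :=
  {x | ∀ᵐ ω ∂μ, x ∈ M ω}

/-- The Aumann integral over `Ω`: the set of integrals of all integrable a.e. selections. -/
def aumannIntegral (μ : Measure Ω) (F : Ω → Set E) : Set E :=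
  {v | ∃ f : Ω → E, Integrable f μ ∧ (∀ᵐ ω ∂μ, f ω ∈ F ω) ∧ ∫ ω, f ω ∂μ = v}

end EssInter

end

/-! Penalise the constraint `y ∈ M_∩` by `G(y) = ∫ g(ω) dist(y, M(ω))² dμ`, where `g > 0` is
integrable. `G` is continuous and vanishes exactly on the essential intersection. For a regular
normal `v` at `x` and large `k`, the function `2ε‖y - x‖ - ⟨v, y - x⟩ + k G(y)` has a local
minimiser `z` (`exists_isLocalMin_penalised`). With `p(ω)` a measurable nearest point to `z` in
`M(ω)`, `G(z + u) ≤ G(z) + 2⟨∫ g (z - p), u⟩ + O(‖u‖²)`, so minimality gives `‖v - 2k ∫ g (z - p)‖ ≤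
2ε`. The integrand lies in `N(0; M(ω))`: `z - p` is a proximal normal at `p`, hence, `M(ω)` being a
cone, a regular normal at every `s p` with `s > 0`; let `s → 0`
(`IsClosedCone.smul_sub_mem_limitingNormalCone`). Thus `v` is a limit of elements of the Aumann
integral, and limiting normals follow by closedness. -/

namespace EssInter

/-! ### Measurable selections of closed-valued mappings. -/

section Selection

variable {Ω : Type*} [MeasurableSpace Ω] {X : Type*} [MetricSpace X] [MeasurableSpace X]
  [BorelSpace X]

open Classical in
/-- One refinement step in the construction of a measurable selection. -/
theorem exists_measurable_approx_selection [TopologicalSpace.SeparableSpace X]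
    {P : Ω → Set X} (hne : ∀ ω, (P ω).Nonempty)
    (hmeas : ∀ q, Measurable fun ω => Metric.infDist q (P ω))
    {g : Ω → X} (hg : Measurable g) {δ δ' : ℝ} (hδ' : 0 < δ')
    (hgδ : ∀ ω, Metric.infDist (g ω) (P ω) < δ) :
    ∃ g' : Ω → X, Measurable g' ∧ (∀ ω, Metric.infDist (g' ω) (P ω) < δ') ∧
      ∀ ω, dist (g ω) (g' ω) < δ + δ' := by
  rcases isEmpty_or_nonempty Ω with hΩ | ⟨⟨ω₀⟩⟩
  · exact ⟨g, hg, fun ω => hΩ.elim ω, fun ω => hΩ.elim ω⟩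
  have : Nonempty X := ⟨g ω₀⟩
  let q := TopologicalSpace.denseSeq X
  -- Choosing the first suitable index in a countable dense sequence keeps the choice measurable.
  have hex : ∀ ω, ∃ i, Metric.infDist (q i) (P ω) < δ' ∧ dist (g ω) (q i) < δ + δ' := by
    intro ω
    obtain ⟨p, hp, hpd⟩ := (Metric.infDist_lt_iff (hne ω)).1 (hgδ ω)
    obtain ⟨i, hi⟩ := (TopologicalSpace.denseRange_denseSeq X).exists_dist_lt p hδ'
    refine ⟨i, (Metric.infDist_lt_iff (hne ω)).2 ⟨p, hp, by rwa [dist_comm]⟩, ?_⟩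
    have := dist_triangle (g ω) p (q i)
    linarith
  refine ⟨fun ω => q (Nat.find (hex ω)), ?_, fun ω => (Nat.find_spec (hex ω)).1,
    fun ω => (Nat.find_spec (hex ω)).2⟩
  refine Measurable.find (f := fun i _ => q i) (fun i => measurable_const) (fun i => ?_) hex
  exact (measurableSet_lt (hmeas _) measurable_const).inter
    (measurableSet_lt (hg.dist measurable_const) measurable_const)

open Classical in
/-- **Kuratowski–Ryll-Nardzewski**: a closed-valued mapping with measurable distance functions
has a measurable selection. -/
theorem exists_measurable_selection [TopologicalSpace.SeparableSpace X] [CompleteSpace X]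
    [Nonempty X] {P : Ω → Set X} (hcl : ∀ ω, IsClosed (P ω)) (hne : ∀ ω, (P ω).Nonempty)
    (hmeas : ∀ q, Measurable fun ω => Metric.infDist q (P ω)) :
    ∃ f : Ω → X, Measurable f ∧ ∀ ω, f ω ∈ P ω := by
  let S : ℕ → Type _ := fun k =>
    {g : Ω → X // Measurable g ∧ ∀ ω, Metric.infDist (g ω) (P ω) < (1 / 2 : ℝ) ^ k}
  have h0 : Nonempty (S 0) := by
    have hex : ∀ ω, ∃ i, Metric.infDist (TopologicalSpace.denseSeq X i) (P ω) < 1 := by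
      intro ω
      obtain ⟨p, hp⟩ := hne ω
      obtain ⟨i, hi⟩ := (TopologicalSpace.denseRange_denseSeq X).exists_dist_lt p one_pos
      exact ⟨i, (Metric.infDist_lt_iff (hne ω)).2 ⟨p, hp, by rwa [dist_comm]⟩⟩
    refine ⟨fun ω => TopologicalSpace.denseSeq X (Nat.find (hex ω)), ?_, fun ω => ?_⟩
    · exact Measurable.find (f := fun i _ => TopologicalSpace.denseSeq X i)
        (fun i => measurable_const) (fun i => measurableSet_lt (hmeas _) measurable_const) hex
    · simpa using Nat.find_spec (hex ω)
  have hstep : ∀ k (g : S k), ∃ g' : S (k + 1),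
      ∀ ω, dist (g.1 ω) (g'.1 ω) < (1 / 2 : ℝ) ^ k + (1 / 2 : ℝ) ^ (k + 1) := by
    rintro k ⟨g, hg, hgd⟩
    obtain ⟨g', h1, h2, h3⟩ := exists_measurable_approx_selection hne hmeas hg
      (show (0 : ℝ) < (1 / 2) ^ (k + 1) by positivity) hgd
    exact ⟨⟨g', h1, h2⟩, h3⟩
  choose next hnext using hstep
  let s : ∀ k, S k := fun k => Nat.rec h0.some (fun k g => next k g) k
  have hs : ∀ ω k, dist ((s k).1 ω) ((s (k + 1)).1 ω) ≤ 2 * (1 / 2 : ℝ) ^ k := by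
    intro ω k
    have := (hnext k (s k) ω).le
    have h2 : (0 : ℝ) < (1 / 2) ^ k := by positivity
    have h3 : (1 / 2 : ℝ) ^ (k + 1) = (1 / 2) ^ k * (1 / 2) := pow_succ _ _
    change dist ((s k).1 ω) ((next k (s k)).1 ω) ≤ _
    linarith
  have hlim : ∀ ω, ∃ p, Tendsto (fun k => (s k).1 ω) atTop (𝓝 p) := fun ω =>
    cauchySeq_tendsto_of_complete
      (cauchySeq_of_le_geometric (1 / 2) 2 (by norm_num) (hs ω))
  choose f hf using hlim
  refine ⟨f, measurable_of_tendsto_metrizable (fun k => (s k).2.1) (tendsto_pi_nhds.2 hf),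
    fun ω => ?_⟩
  rw [(hcl ω).mem_iff_infDist_zero (hne ω)]
  refine le_antisymm ?_ Metric.infDist_nonneg
  refine le_of_tendsto_of_tendsto
    ((Metric.continuous_infDist_pt (P ω)).continuousAt.tendsto.comp (hf ω))
    (tendsto_pow_atTop_nhds_zero_of_lt_one (r := (1 / 2 : ℝ)) (by norm_num) (by norm_num))
    (Eventually.of_forall fun k => ((s k).2.2 ω).le)

end Selection

/-! ### Measurable nearest-point projections. -/

section Projection

variable {Ω : Type*} [MeasurableSpace Ω] {E : Type*} [NormedAddCommGroup E]
  {M : Ω → Set E}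

theorem MeasurableMultifunction.measurable_infDist (hM : MeasurableMultifunction M)
    (hne : ∀ ω, (M ω).Nonempty) (q : E) : Measurable fun ω => Metric.infDist q (M ω) := by
  refine measurable_of_Iio fun r => ?_
  convert hM (Metric.ball q r) Metric.isOpen_ball using 1
  ext ω
  simp only [Set.mem_preimage, Set.mem_Iio, Metric.infDist_lt_iff (hne ω)]
  exact ⟨fun ⟨y, hy, h⟩ => ⟨y, hy, by rwa [Metric.mem_ball, dist_comm]⟩,
    fun ⟨y, hy, h⟩ => ⟨y, hy, by rwa [Metric.mem_ball, dist_comm] at h⟩⟩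

/-- A point of a closed set meets two closed balls as soon as the set meets all slightly larger
open balls. -/
theorem exists_mem_closedBall_inter_iff [ProperSpace E] {K : Set E} (hK : IsClosed K)
    (z q : E) (d r : ℝ) :
    (∃ p ∈ K, dist z p ≤ d ∧ dist q p ≤ r) ↔
      ∀ m : ℕ, ∃ s : ℚ, (s : ℝ) < d + 1 / (m + 1) ∧
        (K ∩ (Metric.ball z s ∩ Metric.ball q (r + 1 / (m + 1)))).Nonempty := by
  have hpos : ∀ m : ℕ, (0 : ℝ) < 1 / (m + 1) := fun m => Nat.one_div_pos_of_nat
  constructor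
  · rintro ⟨p, hp, h1, h2⟩ m
    obtain ⟨s, hs1, hs2⟩ := exists_rat_btwn (show dist z p < d + 1 / ((m : ℝ) + 1) by
      linarith [hpos m])
    refine ⟨s, hs2, p, hp, by rwa [Metric.mem_ball, dist_comm], ?_⟩
    rw [Metric.mem_ball, dist_comm]
    linarith [hpos m]
  · intro h
    choose s hs p hpK hpz hpq using h
    have hb : ∀ m, p m ∈ Metric.closedBall z (d + 1) := fun m => by
      have h1 : (1 : ℝ) / (m + 1) ≤ 1 := by
        rw [div_le_one (by positivity)]
        linarith [(Nat.cast_nonneg m : (0 : ℝ) ≤ m)]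
      have := Metric.mem_ball.1 (hpz m)
      exact Metric.mem_closedBall.2 (by linarith [hs m])
    obtain ⟨a, -, φ, hφ, hlim⟩ := (isCompact_closedBall z (d + 1)).tendsto_subseq hb
    have hφ0 : Tendsto (fun m => (1 : ℝ) / ((φ m : ℝ) + 1)) atTop (𝓝 0) :=
      tendsto_one_div_add_atTop_nhds_zero_nat.comp hφ.tendsto_atTop
    have hbound : ∀ c : ℝ, Tendsto (fun m => c + 1 / ((φ m : ℝ) + 1)) atTop (𝓝 c) := fun c => by
      simpa only [add_zero] using hφ0.const_add c
    refine ⟨a, hK.mem_of_tendsto hlim (Eventually.of_forall fun m => hpK _), ?_, ?_⟩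
    · refine le_of_tendsto_of_tendsto (tendsto_const_nhds.dist hlim)
        (hbound d) (Eventually.of_forall fun m => ?_)
      have := Metric.mem_ball'.1 (hpz (φ m))
      exact (this.trans (hs _)).le
    · refine le_of_tendsto_of_tendsto (tendsto_const_nhds.dist hlim)
        (hbound r) (Eventually.of_forall fun m => ?_)
      exact (Metric.mem_ball'.1 (hpq (φ m))).le

/-- A measurable closed-valued mapping admits a measurable selection of nearest points. -/
theorem exists_measurable_projection [ProperSpace E] [MeasurableSpace E] [BorelSpace E]
    (hM : MeasurableMultifunction M) (hcl : ∀ ω, IsClosed (M ω)) (hne : ∀ ω, (M ω).Nonempty)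
    (z : E) : ∃ p : Ω → E, Measurable p ∧
      ∀ ω, p ω ∈ M ω ∧ dist z (p ω) = Metric.infDist z (M ω) := by
  let P : Ω → Set E := fun ω => M ω ∩ Metric.closedBall z (Metric.infDist z (M ω))
  have hPne : ∀ ω, (P ω).Nonempty := fun ω => by
    obtain ⟨p, hp, h⟩ := (hcl ω).exists_infDist_eq_dist (hne ω) z
    exact ⟨p, hp, by rw [Metric.mem_closedBall', h]⟩
  have hPcl : ∀ ω, IsClosed (P ω) := fun ω => (hcl ω).inter Metric.isClosed_closedBall
  obtain ⟨p, hp, hpP⟩ := exists_measurable_selection hPcl hPne fun q => by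
    refine measurable_of_Iic fun r => ?_
    -- The radius of the ball in `P ω` varies with `ω`; rational radii `s` reduce to countably many
    -- fixed open sets, to which `hM` applies.
    have : (fun ω => Metric.infDist q (P ω)) ⁻¹' Set.Iic r =
        ⋂ m : ℕ, ⋃ s : ℚ, {ω | (s : ℝ) < Metric.infDist z (M ω) + 1 / (m + 1)} ∩
          {ω | (M ω ∩ (Metric.ball z s ∩ Metric.ball q (r + 1 / (m + 1)))).Nonempty} := by
      ext ω
      have := exists_mem_closedBall_inter_iff (hcl ω) z q (Metric.infDist z (M ω)) r
      simp only [Set.mem_preimage, Set.mem_Iic, Set.mem_iInter, Set.mem_iUnion, Set.mem_inter_iff,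
        Set.mem_ofPred_eq]
      rw [← this]
      constructor
      · intro h
        obtain ⟨a, ha, hd⟩ := (hPcl ω).exists_infDist_eq_dist (hPne ω) q
        exact ⟨a, ha.1, Metric.mem_closedBall'.1 ha.2, hd ▸ h⟩
      · rintro ⟨a, haM, h1, h2⟩
        exact (Metric.infDist_le_dist_of_mem
          (show a ∈ P ω from ⟨haM, Metric.mem_closedBall'.2 h1⟩)).trans h2
    rw [this]
    exact MeasurableSet.iInter fun m => MeasurableSet.iUnion fun s =>
      (measurableSet_lt measurable_const ((hM.measurable_infDist hne z).add_const _)).inter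
        (hM _ (Metric.isOpen_ball.inter Metric.isOpen_ball))
  exact ⟨p, hp, fun ω => ⟨(hpP ω).1, le_antisymm (Metric.mem_closedBall'.1 (hpP ω).2)
    (Metric.infDist_le_dist_of_mem (hpP ω).1)⟩⟩

end Projection

/-! ### Regular and limiting normals; closed cones. -/

section NormalCones

variable {E : Type*} [NormedAddCommGroup E] [InnerProductSpace ℝ E]

/-- Proximal normals are regular normals. -/
theorem mem_regularNormalCone_of_inner_le_sq {Θ : Set E} {a p : E} {c : ℝ} (hp : p ∈ Θ)
    (h : ∀ y ∈ Θ, inner ℝ a (y - p) ≤ c * ‖y - p‖ ^ 2) : a ∈ regularNormalCone p Θ := by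
  refine ⟨hp, ?_⟩
  refine EReal.le_of_forall_lt_iff_le.1 fun ε hε => ?_
  have hε' : 0 < ε := by exact_mod_cast hε
  refine limsup_le_of_le (by isBoundedDefault) ?_
  have hlim : Tendsto (fun y => c * ‖y - p‖) (𝓝 p) (𝓝 0) := by
    have : Continuous fun y => c * ‖y - p‖ := by fun_prop
    simpa using this.tendsto p
  filter_upwards [self_mem_nhdsWithin,
    nhdsWithin_le_nhds (hlim.eventually (gt_mem_nhds hε'))] with y hy hyε
  have hpos : 0 < ‖y - p‖ := norm_pos_iff.2 (sub_ne_zero.2 hy.2)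
  have := h y hy.1
  refine EReal.coe_le_coe_iff.2 ?_
  rw [div_le_iff₀ hpos]
  nlinarith

theorem exists_inner_le_of_mem_regularNormalCone {Θ : Set E} {v x : E}
    (hv : v ∈ regularNormalCone x Θ) {ε : ℝ} (hε : 0 < ε) :
    ∃ r > 0, ∀ z ∈ Θ, ‖z - x‖ ≤ r → inner ℝ v (z - x) ≤ ε * ‖z - x‖ := by
  have h1 : limsup (fun y : E => ((inner ℝ v (y - x) / ‖y - x‖ : ℝ) : EReal)) (𝓝[Θ \ {x}] x)
      < (ε : EReal) := hv.2.trans_lt (by exact_mod_cast hε)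
  have h2 := eventually_lt_of_limsup_lt h1 (by isBoundedDefault)
  obtain ⟨r, hr, hball⟩ := Metric.mem_nhdsWithin_iff.1 h2
  refine ⟨r / 2, by positivity, fun z hz hzr => ?_⟩
  rcases eq_or_ne z x with rfl | hzx
  · simp
  have hpos : 0 < ‖z - x‖ := norm_pos_iff.2 (sub_ne_zero.2 hzx)
  have := hball ⟨show z ∈ Metric.ball x r by
    rw [Metric.mem_ball, dist_eq_norm]; linarith, hz, hzx⟩
  have h3 : inner ℝ v (z - x) / ‖z - x‖ < ε := EReal.coe_lt_coe_iff.1 this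
  exact ((div_lt_iff₀ hpos).1 h3).le

theorem IsClosedCone.zero_mem {K : Set E} (hK : IsClosedCone K) : (0 : E) ∈ K := by
  obtain ⟨p, hp⟩ := hK.nonempty
  have h : Tendsto (fun m : ℕ => ((1 : ℝ) / (m + 1)) • p) atTop (𝓝 0) := by
    simpa using (tendsto_one_div_add_atTop_nhds_zero_nat (𝕜 := ℝ)).smul_const p
  exact hK.isClosed.mem_of_tendsto h (Eventually.of_forall fun m =>
    hK.smul_mem _ Nat.one_div_pos_of_nat _ hp)

/-- The residual of a nearest-point projection onto a closed cone is a limiting normal at the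
apex. -/
theorem IsClosedCone.smul_sub_mem_limitingNormalCone {K : Set E} (hK : IsClosedCone K)
    {z p : E} (hp : p ∈ K) (hmin : ∀ y ∈ K, dist z p ≤ dist z y) {c : ℝ} (hc : 0 ≤ c) :
    c • (z - p) ∈ limitingNormalCone 0 K := by
  have hpos : ∀ m : ℕ, (0 : ℝ) < 1 / (m + 1) := fun m => Nat.one_div_pos_of_nat
  have key : ∀ y ∈ K, 2 * inner ℝ (z - p) (y - p) ≤ ‖y - p‖ ^ 2 := by
    intro y hy
    have h1 := hmin y hy
    rw [dist_eq_norm, dist_eq_norm] at h1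
    have h2 : ‖z - p‖ ^ 2 ≤ ‖z - y‖ ^ 2 := by gcongr
    have h3 : z - y = (z - p) - (y - p) := by abel
    rw [h3, norm_sub_sq_real (z - p) (y - p)] at h2
    linarith
  refine ⟨hK.zero_mem, fun m => ((1 : ℝ) / (m + 1)) • p, fun _ => c • (z - p),
    fun m => hK.smul_mem _ (hpos m) _ hp, ?_, tendsto_const_nhds, fun m => ?_⟩
  · simpa using (tendsto_one_div_add_atTop_nhds_zero_nat (𝕜 := ℝ)).smul_const p
  · set s : ℝ := 1 / (m + 1) with hs
    have hs0 : 0 < s := hpos m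
    refine mem_regularNormalCone_of_inner_le_sq (c := c * (s⁻¹ / 2))
      (hK.smul_mem _ hs0 _ hp) fun y hy => ?_
    -- Scaling by `s⁻¹` carries the proximal inequality from `p` to `s • p`.
    have h1 := key (s⁻¹ • y) (hK.smul_mem _ (inv_pos.2 hs0) _ hy)
    have h2 : s⁻¹ • y - p = s⁻¹ • (y - s • p) := by
      rw [smul_sub, smul_smul, inv_mul_cancel₀ hs0.ne', one_smul]
    rw [h2, inner_smul_right, norm_smul, mul_pow, Real.norm_eq_abs, sq_abs] at h1
    have h3 : 2 * inner ℝ (z - p) (y - s • p) ≤ s⁻¹ * ‖y - s • p‖ ^ 2 := by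
      refine le_of_mul_le_mul_left ?_ (inv_pos.2 hs0)
      nlinarith
    rw [inner_smul_left]
    simp only [conj_trivial]
    nlinarith

end NormalCones

/-! ### The integral penalty function. -/

section MeanSqDist

variable {Ω : Type*} [MeasurableSpace Ω] {E : Type*} [NormedAddCommGroup E]
  {μ : Measure Ω} {M : Ω → Set E} {g : Ω → ℝ}

/-- The weighted mean square distance from `z` to the sets `M ω`. -/
noncomputable def meanSqDist (μ : Measure Ω) (g : Ω → ℝ) (M : Ω → Set E) (z : E) : ℝ :=
  ∫ ω, g ω * Metric.infDist z (M ω) ^ 2 ∂μ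

theorem integrable_mul_infDist_sq (hM : MeasurableMultifunction M)
    (h0 : ∀ ω, (0 : E) ∈ M ω) (hg : Integrable g μ) (z : E) :
    Integrable (fun ω => g ω * Metric.infDist z (M ω) ^ 2) μ := by
  refine hg.mul_bdd (c := ‖z‖ ^ 2)
    ((hM.measurable_infDist (fun ω => ⟨0, h0 ω⟩) z).pow_const 2).aestronglyMeasurable
    (Eventually.of_forall fun ω => ?_)
  have h1 : Metric.infDist z (M ω) ≤ ‖z‖ := by
    simpa using Metric.infDist_le_dist_of_mem (x := z) (h0 ω)
  have h2 : 0 ≤ Metric.infDist z (M ω) := Metric.infDist_nonneg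
  rw [Real.norm_eq_abs, abs_of_nonneg (by positivity)]
  gcongr

/-- Dominated convergence: since `0 ∈ M ω`, distances are at most `‖z‖`, which is locally bounded.
-/
theorem continuous_meanSqDist (hM : MeasurableMultifunction M) (h0 : ∀ ω, (0 : E) ∈ M ω)
    (hg : Integrable g μ) : Continuous (meanSqDist μ g M) := by
  refine continuous_iff_continuousAt.2 fun x => ?_
  refine continuousAt_of_dominated (bound := fun ω => ‖g ω‖ * (‖x‖ + 1) ^ 2)
    (Eventually.of_forall fun z => (integrable_mul_infDist_sq hM h0 hg z).aestronglyMeasurable)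
    ?_ (hg.norm.mul_const _) (Eventually.of_forall fun ω => ?_)
  · filter_upwards [Metric.ball_mem_nhds x one_pos] with z hz
    refine Eventually.of_forall fun ω => ?_
    have h1 : Metric.infDist z (M ω) ≤ ‖z‖ := by
      simpa using Metric.infDist_le_dist_of_mem (x := z) (h0 ω)
    have h2 : 0 ≤ Metric.infDist z (M ω) := Metric.infDist_nonneg
    have h3 : ‖z‖ ≤ ‖x‖ + 1 := by
      have := norm_sub_norm_le z x
      rw [Metric.mem_ball, dist_eq_norm] at hz
      linarith
    rw [norm_mul, norm_pow, Real.norm_eq_abs (Metric.infDist z (M ω)), abs_of_nonneg h2]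
    gcongr
    exact h1.trans h3
  · exact (((Metric.continuous_infDist_pt (M ω)).pow 2).const_mul (g ω)).continuousAt

theorem meanSqDist_nonneg (hg0 : ∀ ω, 0 < g ω) (z : E) : 0 ≤ meanSqDist μ g M z :=
  integral_nonneg fun ω => mul_nonneg (hg0 ω).le (sq_nonneg _)

theorem meanSqDist_eq_zero_iff (hM : MeasurableMultifunction M) (h0 : ∀ ω, (0 : E) ∈ M ω)
    (hcl : ∀ ω, IsClosed (M ω)) (hg : Integrable g μ) (hg0 : ∀ ω, 0 < g ω) (z : E) :
    meanSqDist μ g M z = 0 ↔ z ∈ essIntersection μ M := by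
  rw [meanSqDist, integral_eq_zero_iff_of_nonneg
    (fun ω => mul_nonneg (hg0 ω).le (sq_nonneg _)) (integrable_mul_infDist_sq hM h0 hg z)]
  refine eventually_congr (Eventually.of_forall fun ω => ?_)
  rw [(hcl ω).mem_iff_infDist_zero ⟨0, h0 ω⟩]
  simp [(hg0 ω).ne']

end MeanSqDist

/-! ### Penalisation and the normal cone inclusion. -/

section EssentialIntersection

variable {Ω : Type*} [MeasurableSpace Ω] {E : Type*} [NormedAddCommGroup E]
  [InnerProductSpace ℝ E] {μ : Measure Ω} {M : Ω → Set E}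

/-- Penalty localisation: for a large penalty parameter the penalised support functional
has an interior minimiser. -/
theorem exists_isLocalMin_penalised [ProperSpace E] {K : Set E} {G : E → ℝ}
    (hG : Continuous G) (hG0 : ∀ z, 0 ≤ G z) (hGK : ∀ z, G z = 0 ↔ z ∈ K) {v x : E}
    (hv : v ∈ regularNormalCone x K) {ε : ℝ} (hε : 0 < ε) :
    ∃ k : ℝ, 0 ≤ k ∧ ∃ z, IsLocalMin
      (fun y => 2 * ε * ‖y - x‖ - inner ℝ v (y - x) + k * G y) z := by
  obtain ⟨r, hr, hK⟩ := exists_inner_le_of_mem_regularNormalCone hv hε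
  have hxK : G x = 0 := (hGK x).2 hv.1
  have hcont : ∀ k : ℝ,
      Continuous fun y => 2 * ε * ‖y - x‖ - inner ℝ v (y - x) + k * G y := by
    intro k; fun_prop
  have hk : ∃ k : ℕ, ∀ y ∈ Metric.sphere x r,
      0 < 2 * ε * ‖y - x‖ - inner ℝ v (y - x) + k * G y := by
    -- Otherwise nonpositive values on the sphere for every `k` force `G (y k) → 0`; a cluster point
    -- `a` lies in `K` with `2εr ≤ ⟨v, a - x⟩ ≤ εr`, which is absurd.
    by_contra! hcon
    choose y hyS hy using hcon
    obtain ⟨a, haS, φ, hφ, hlim⟩ := (isCompact_sphere x r).tendsto_subseq hyS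
    have har : ‖a - x‖ = r := by rwa [mem_sphere_iff_norm] at haS
    have hbd : ∀ k : ℕ, k * G (y k) ≤ ‖v‖ * r := by
      intro k
      have h1 : ‖y k - x‖ = r := by simpa [mem_sphere_iff_norm] using hyS k
      have h2 := real_inner_le_norm v (y k - x)
      have h3 := hy k
      rw [h1] at h2 h3
      nlinarith
    have hGa : G a = 0 := by
      refine le_antisymm ?_ (hG0 a)
      have hz : Tendsto (fun m : ℕ => ‖v‖ * r / (φ m : ℝ)) atTop (𝓝 0) :=
        (tendsto_const_nhds.div_atTop tendsto_natCast_atTop_atTop).comp hφ.tendsto_atTop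
      refine le_of_tendsto_of_tendsto ((hG.tendsto a).comp hlim) hz ?_
      filter_upwards [hφ.tendsto_atTop.eventually (eventually_gt_atTop 0)] with m hm
      rw [le_div_iff₀ (by exact_mod_cast hm), mul_comm]
      exact hbd _
    have h1 := hK a ((hGK a).1 hGa) har.le
    have h2 : 2 * ε * ‖a - x‖ - inner ℝ v (a - x) ≤ 0 := by
      have hc : Continuous fun y => 2 * ε * ‖y - x‖ - inner ℝ v (y - x) := by fun_prop
      refine le_of_tendsto ((hc.tendsto a).comp hlim) (Eventually.of_forall fun m => ?_)
      have h3 := hy (φ m)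
      have h4 : 0 ≤ (φ m : ℝ) * G (y (φ m)) := mul_nonneg (Nat.cast_nonneg _) (hG0 _)
      simp only [Function.comp_apply]
      linarith
    rw [har] at h1 h2
    nlinarith
  obtain ⟨k, hk⟩ := hk
  obtain ⟨z, hz, hmin⟩ := (isCompact_closedBall x r).exists_isMinOn
    ⟨x, Metric.mem_closedBall_self hr.le⟩ (hcont k).continuousOn
  refine ⟨k, Nat.cast_nonneg k, z, hmin.isLocalMin ?_⟩
  -- The objective is `0` at the centre and positive on the sphere, so `z` is interior.
  have hle := hmin (Metric.mem_closedBall_self hr.le)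
  simp only [Set.mem_ofPred_eq, sub_self, norm_zero, mul_zero, inner_zero_right, hxK,
    add_zero] at hle
  have hball : z ∈ Metric.ball x r := by
    refine lt_of_le_of_ne (Metric.mem_closedBall.1 hz) fun h => ?_
    exact absurd (hk z h) (not_lt.2 hle)
  exact Filter.mem_of_superset (Metric.isOpen_ball.mem_nhds hball) Metric.ball_subset_closedBall

/-- A first-order inequality with a quadratic remainder. -/
theorem le_of_eventually_mul_le_add_sq {a b C : ℝ}
    (h : ∀ᶠ t : ℝ in 𝓝[>] 0, t * a ≤ t * b + t ^ 2 * C) : a ≤ b := by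
  have hlim : Tendsto (fun t : ℝ => b + t * C) (𝓝[>] 0) (𝓝 b) := by
    have : Continuous fun t : ℝ => b + t * C := by fun_prop
    simpa using (this.tendsto 0).mono_left nhdsWithin_le_nhds
  refine ge_of_tendsto hlim ?_
  filter_upwards [h, self_mem_nhdsWithin] with t ht ht0
  refine le_of_mul_le_mul_left ?_ (show (0 : ℝ) < t from ht0)
  nlinarith

/-- Regular normals to an essential intersection of closed cones belong to the closure of the
Aumann integral of the normal cones at the apex. -/
theorem regularNormalCone_essIntersection_subset [ProperSpace E] [SigmaFinite μ]
    (hM : MeasurableMultifunction M) (hcone : ∀ ω, IsClosedCone (M ω)) (x : E) :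
    regularNormalCone x (essIntersection μ M) ⊆
      closure (aumannIntegral μ fun ω => limitingNormalCone 0 (M ω)) := by
  intro v hv
  borelize E
  have h0 : ∀ ω, (0 : E) ∈ M ω := fun ω => (hcone ω).zero_mem
  have hcl : ∀ ω, IsClosed (M ω) := fun ω => (hcone ω).isClosed
  obtain ⟨w, hwpos, hwm, hwint⟩ := exists_pos_lintegral_lt_of_sigmaFinite μ one_ne_zero
  set g : Ω → ℝ := fun ω => w ω with hgdef
  have hg : Integrable g μ := by
    refine ⟨hwm.coe_nnreal_real.aestronglyMeasurable, ?_⟩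
    simpa [HasFiniteIntegral, hgdef, enorm] using hwint.trans ENNReal.one_lt_top
  have hg0 : ∀ ω, 0 < g ω := fun ω => hwpos ω
  refine Metric.mem_closure_iff.2 fun δ hδ => ?_
  -- The final error is at most `2ε = δ / 2 < δ`.
  set ε := δ / 4 with hεdef
  have hε : 0 < ε := by positivity
  obtain ⟨k, hk, z, hz⟩ := exists_isLocalMin_penalised (continuous_meanSqDist hM h0 hg)
    (meanSqDist_nonneg hg0) (meanSqDist_eq_zero_iff hM h0 hcl hg hg0) hv hε
  obtain ⟨p, hpm, hp⟩ := exists_measurable_projection hM hcl (fun ω => ⟨0, h0 ω⟩) z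
  have hzp : ∀ ω, ‖z - p ω‖ ≤ ‖z‖ := fun ω => by
    rw [← dist_eq_norm, (hp ω).2]
    simpa using Metric.infDist_le_dist_of_mem (x := z) (h0 ω)
  have hf : Integrable (fun ω => g ω • (z - p ω)) μ :=
    hg.smul_bdd ‖z‖ (hpm.const_sub z).aestronglyMeasurable (Eventually.of_forall hzp)
  have hupper : ∀ u, meanSqDist μ g M (z + u) ≤ meanSqDist μ g M z
      + 2 * inner ℝ (∫ ω, g ω • (z - p ω) ∂μ) u + ‖u‖ ^ 2 * ∫ ω, g ω ∂μ := by
    intro u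
    have hin : Integrable (fun ω => inner ℝ (g ω • (z - p ω)) u) μ := hf.inner_const u
    have hinteq : inner ℝ (∫ ω, g ω • (z - p ω) ∂μ) u
        = ∫ ω, inner ℝ (g ω • (z - p ω)) u ∂μ := by
      rw [real_inner_comm, ← integral_inner hf]
      simp only [real_inner_comm]
    have hz2 := integrable_mul_infDist_sq hM h0 hg z
    rw [hinteq, meanSqDist, meanSqDist, ← integral_const_mul, ← integral_const_mul,
      ← integral_add hz2 (hin.const_mul 2),
      ← integral_add (f := fun ω => g ω * Metric.infDist z (M ω) ^ 2 +
        2 * inner ℝ (g ω • (z - p ω)) u) (hz2.add (hin.const_mul 2)) (hg.const_mul _)]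
    refine integral_mono (integrable_mul_infDist_sq hM h0 hg _)
      ((hz2.add (hin.const_mul 2)).add (hg.const_mul _)) fun ω => ?_
    -- Keeping the old projection `p ω` as competitor gives the upper expansion without
    -- differentiating the distance.
    have h1 : Metric.infDist (z + u) (M ω) ≤ ‖(z - p ω) + u‖ := by
      have := Metric.infDist_le_dist_of_mem (x := z + u) (hp ω).1
      rwa [dist_eq_norm, add_sub_right_comm] at this
    have h2 : Metric.infDist (z + u) (M ω) ^ 2 ≤ ‖(z - p ω) + u‖ ^ 2 :=
      pow_le_pow_left₀ Metric.infDist_nonneg h1 2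
    rw [norm_add_sq_real] at h2
    beta_reduce
    rw [← (hp ω).2, dist_eq_norm, inner_smul_left]
    simp only [conj_trivial]
    nlinarith [mul_le_mul_of_nonneg_left h2 (hg0 ω).le]
  set b : E := (2 * k) • ∫ ω, g ω • (z - p ω) ∂μ with hb
  have hfirst : ∀ u, inner ℝ (v - b) u ≤ 2 * ε * ‖u‖ := by
    intro u
    refine le_of_eventually_mul_le_add_sq (C := k * (‖u‖ ^ 2 * ∫ ω, g ω ∂μ)) ?_
    have ht : Tendsto (fun t : ℝ => z + t • u) (𝓝[>] 0) (𝓝 z) := by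
      have : Continuous fun t : ℝ => z + t • u := by fun_prop
      simpa using (this.tendsto 0).mono_left nhdsWithin_le_nhds
    filter_upwards [ht.eventually hz, self_mem_nhdsWithin] with t hmin ht0
    have ht0' : (0 : ℝ) < t := ht0
    have h1 := mul_le_mul_of_nonneg_left (hupper (t • u)) hk
    have h2 : z + t • u - x = (z - x) + t • u := by abel
    have h3 : ‖(z - x) + t • u‖ ≤ ‖z - x‖ + t * ‖u‖ := by
      refine (norm_add_le _ _).trans_eq ?_
      rw [norm_smul, Real.norm_eq_abs, abs_of_pos ht0']
    rw [h2, inner_add_right, inner_smul_right] at hmin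
    rw [inner_smul_right, norm_smul, Real.norm_eq_abs, abs_of_pos ht0'] at h1
    have h4 := mul_le_mul_of_nonneg_left h3 hε.le
    rw [inner_sub_left, hb, inner_smul_left]
    simp only [conj_trivial]
    nlinarith
  refine ⟨b, ⟨fun ω => (2 * k) • (g ω • (z - p ω)), hf.smul _, Eventually.of_forall fun ω => ?_,
    by rw [integral_smul]⟩, ?_⟩
  · simp only [smul_smul]
    refine (hcone ω).smul_sub_mem_limitingNormalCone (hp ω).1 (fun y hy => ?_)
      (mul_nonneg (by positivity) (hg0 ω).le)
    rw [(hp ω).2]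
    exact Metric.infDist_le_dist_of_mem hy
  · rw [dist_eq_norm]
    -- Testing with `u = v - b` turns the directional bound into a norm bound.
    have h1 := hfirst (v - b)
    rw [real_inner_self_eq_norm_sq] at h1
    by_contra! hcon
    nlinarith

theorem limitingNormalCone_essIntersection_subset [ProperSpace E] [SigmaFinite μ]
    (hM : MeasurableMultifunction M) (hcone : ∀ ω, IsClosedCone (M ω)) (x : E) :
    limitingNormalCone x (essIntersection μ M) ⊆
      closure (aumannIntegral μ fun ω => limitingNormalCone 0 (M ω)) := by
  rintro v ⟨-, y, w, -, -, hw, hreg⟩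
  exact isClosed_closure.mem_of_tendsto hw
    (Eventually.of_forall fun k => regularNormalCone_essIntersection_subset hM hcone _ (hreg k))

end EssentialIntersection

end EssInter

theorem theorem4p2 {n : ℕ} {Ω : Type*} [MeasurableSpace Ω]
    (μ : Measure Ω) [SigmaFinite μ] [μ.IsComplete] (hμ : 0 < μ Set.univ)
    (M : Ω → Set (EuclideanSpace ℝ (Fin n)))
    (hMmeas : EssInter.MeasurableMultifunction M)
    (hMcone : ∀ ω, EssInter.IsClosedCone (M ω))
    (x : EuclideanSpace ℝ (Fin n)) :
    EssInter.limitingNormalCone x (EssInter.essIntersection μ M) ⊆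
      closure (EssInter.aumannIntegral μ
        (fun ω => EssInter.limitingNormalCone 0 (M ω))) :=
  EssInter.limitingNormalCone_essIntersection_subset hMmeas hMcone x
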